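/- All graphs are finite and simple. For a set $E'$ of edges of a graph, the diameter of $E'$ is the diameter of the graph with edge set $E'$ whose vertices are the vertices lying on at least one edge of $E'$; it is $\infty$ if this graph is disconnected. For $n\in\mathbb N$, $\epsilon>0$ and $d\ge 1$, let $Q(n,\epsilon,d)$ be the minimum $\ell$ such that the edge set of every graph $G=(V,E)$ on $n$ vertices with minimum degree at least $\epsilon n$ can be covered by $\ell$ (not necessarily disjoint) sets, $E=E_1\cup\dots\cup E_\ell$, each of diameter at most $d$. Logarithms are in base $2$. **Theorem.** (a) For every fixed $\epsilon$ with $0<\epsilon\le 2^{-8}$, both $Q(n,\epsilon,3)=\Theta(\log n)$ and $Q(n,\epsilon,4)=\Theta(\log n)$ as $n\to\infty$. (b) $Q(n,\epsilon,5)=\Theta(1/\epsilon^2)$ and $Q(n,\epsilon,6)=\Theta(1/\epsilon)$, with absolute constants, in the following sense. - There is a constant $C>0$ such that $Q(n,\epsilon,5)\le C\epsilon^{-2}$ and $Q(n,\epsilon,6)\le C\epsilon^{-1}$ for all $n$ and all $\epsilon>0$. - There are constants $c,c'>0$ such that $Q(n,\epsilon,5)\ge c\,\epsilon^{-2}$ for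 all $n$ and $\epsilon$ with $\epsilon>c'(\log n)^{-1/3}$ and $\epsilon n\le n-1$. - There is a constant $c>0$ such that $Q(n,\epsilon,6)\ge c\,\epsilon^{-1}$ for all $n$ and $\epsilon$ with $\epsilon\ge 1/n$ and $\epsilon n\le n-1$. (The condition $\epsilon n\le n-1$ says exactly that graphs on $n\ge 1$ vertices with minimum degree at least $\epsilon n$ exist.) -/

import Mathlib

/-- The diameter of an edge set `E`: the diameter of the graph whose edge set is `E` and whose
vertices are the vertices lying on at least one edge of `E`. It is `⊤` if this graph is
disconnected. (It is `0` for `E = ∅`.) -/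
noncomputable def edgeSetDiam {V : Type*} (E : Set (Sym2 V)) : ℕ∞ :=
  ((SimpleGraph.fromEdgeSet E).induce {v : V | ∃ e ∈ E, v ∈ e}).ediam

/-- The edges of `G` can be covered by `l` (not necessarily disjoint) sets of edges of `G`, each of
diameter at most `d`. -/
def HasLowDiamCover {V : Type*} (G : SimpleGraph V) (d l : ℕ) : Prop :=
  ∃ E : Fin l → Set (Sym2 V), G.edgeSet = ⋃ i, E i ∧ ∀ i, edgeSetDiam (E i) ≤ d

/-- `coverQ n ε d` is the minimum `l` such that the edges of every graph on `n` vertices with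
minimum degree at least `ε n` can be covered by `l` sets of diameter at most `d`. -/
noncomputable def coverQ (n : ℕ) (ε : ℝ) (d : ℕ) : ℕ :=
  sInf {l : ℕ | ∀ (G : SimpleGraph (Fin n)) [DecidableRel G.Adj],
    ε * (n : ℝ) ≤ (G.minDegree : ℝ) → HasLowDiamCover G d l}

/-- A set of at most one edge has diameter at most one. -/
theorem edgeSetDiam_le_one {V : Type*} {E : Set (Sym2 V)} (hE : E.Subsingleton) :
    edgeSetDiam E ≤ 1 := by
  unfold edgeSetDiam
  rw [SimpleGraph.ediam_def]
  refine iSup_le ?_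
  rintro ⟨⟨u, e, he, hu⟩, ⟨v, f, hf, hv⟩⟩
  obtain rfl := hE he hf
  by_cases huv : u = v
  · subst huv
    simp
  · have hev : e = s(u, v) := (Sym2.mem_and_mem_iff huv).1 ⟨hu, hv⟩
    subst hev
    refine le_of_eq (SimpleGraph.edist_eq_one_iff_adj.2 ?_)
    simp [he, huv]

/-- The minimum in the definition of `coverQ` exists and is attained. -/
theorem coverQ_spec (n : ℕ) (ε : ℝ) {d : ℕ} (hd : 1 ≤ d) (G : SimpleGraph (Fin n))
    [DecidableRel G.Adj] (hG : ε * (n : ℝ) ≤ (G.minDegree : ℝ)) :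
    HasLowDiamCover G d (coverQ n ε d) := by
  have key : {l : ℕ | ∀ (G : SimpleGraph (Fin n)) [DecidableRel G.Adj],
      ε * (n : ℝ) ≤ (G.minDegree : ℝ) → HasLowDiamCover G d l}.Nonempty := by
    refine ⟨Fintype.card (Sym2 (Fin n)), fun G _ _ => ?_⟩
    let φ := (Fintype.equivFin (Sym2 (Fin n))).symm
    refine ⟨fun i => {φ i} ∩ G.edgeSet, ?_, fun i => ?_⟩
    · ext e
      simp only [Set.mem_iUnion, Set.mem_inter_iff, Set.mem_singleton_iff]
      exact ⟨fun h => ⟨φ.symm e, by simp, h⟩, fun ⟨_, _, h⟩ => h⟩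
    · refine (edgeSetDiam_le_one (Set.subsingleton_singleton.anti Set.inter_subset_left)).trans ?_
      exact_mod_cast hd
  exact Nat.sInf_mem key G hG

/-! The upper bounds come from packing and greedy choice. For diameter 6, a maximal family of
vertices with pairwise disjoint neighbourhoods has at most `1/ε` members, and every vertex shares a
neighbour with some member, so every edge lies close to a member (`edgesNear`). For diameter 5 the
same packing is done with oriented edges `(u, v)` and the products `N(u) × N(v)` inside `V × V`,
whence `1/ε²` (`edgesNearDart`). For diameter 3, a pair `(x, y)` is served by each of at least
`ε²n²` pairs `(a, b)` with `a ∈ N(x)`, `b ∈ N(y)`, so `O(log n / ε²)` greedily chosen pairs serve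
all (`doubleStar`).

For the lower bounds, a cover is read as a colouring in which edges of equal colour are close, and
1-Lipschitz functions certify that edges are far apart. Disjoint cliques settle diameter 6.
Diameters 4 and 5 use a gadget graph with port edges indexed by `((a, b), (s, s'))`: a block of an
`r × r` grid and two increasing pairs from `Fin q`. The neighbourhoods of the two ports are dense
sets built from `T s` and `T s'`, yet `T (x, y)` and `T (y, z)` are disjoint
(`exists_shift_design`). Closeness thus runs into the shift graph, whose chromatic number is at
least `log q`. For diameter 4 a single block already forces `log q` colours. For diameter 5, a
colour cannot use two rows and two columns; making `q` exceed `2 ^ r²` then forces about one colour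
per block, up to a factor 2 (`mul_self_le_two_mul_of_coloring`), with `r` about `1 / (128 ε)`. -/

/-! ### Bounding the diameter of an edge set from above and below -/

section EdgeSetDiam

variable {V : Type*} {E : Set (Sym2 V)}

/-- A walk cannot leave `S`, since `S` contains every non-isolated vertex. Distances for
`edgeSetDiam` can therefore be measured on all of `V`. -/
theorem edist_induce_le_length {G : SimpleGraph V} {S : Set V}
    (hS : ∀ x y, G.Adj x y → x ∈ S) {x y : V} (w : G.Walk x y) (hx : x ∈ S) (hy : y ∈ S) :
    (G.induce S).edist ⟨x, hx⟩ ⟨y, hy⟩ ≤ w.length := by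
  induction w with
  | nil => simp
  | @cons u v w h p ih =>
    have hv : v ∈ S := hS v u h.symm
    refine (SimpleGraph.edist_triangle (v := ⟨v, hv⟩)).trans ?_
    have h1 : (G.induce S).edist ⟨u, hx⟩ ⟨v, hv⟩ ≤ 1 :=
      le_of_eq (SimpleGraph.edist_eq_one_iff_adj.2 h)
    calc _ ≤ (1 : ℕ∞) + p.length := add_le_add h1 (ih hv hy)
      _ = _ := by rw [SimpleGraph.Walk.length_cons]; push_cast; ring

theorem edgeSetDiam_le {d : ℕ}
    (h : ∀ x y, (∃ e ∈ E, x ∈ e) → (∃ e ∈ E, y ∈ e) →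
      (SimpleGraph.fromEdgeSet E).edist x y ≤ d) : edgeSetDiam E ≤ d := by
  refine SimpleGraph.ediam_le_of_edist_le ?_
  rintro ⟨x, hx⟩ ⟨y, hy⟩
  have hxy := h x y hx hy
  obtain ⟨w, hw⟩ := SimpleGraph.exists_walk_of_edist_ne_top
    (ne_top_of_le_ne_top (ENat.natCast_ne_top d) hxy)
  rw [← hw] at hxy
  refine (edist_induce_le_length ?_ w hx hy).trans hxy
  intro x y hxy
  exact ⟨s(x, y), ((SimpleGraph.fromEdgeSet_adj E).1 hxy).1, by simp⟩

theorem edist_fromEdgeSet_le_one {x y : V} (h : s(x, y) ∈ E) :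
    (SimpleGraph.fromEdgeSet E).edist x y ≤ 1 := by
  by_cases hxy : x = y
  · subst hxy; simp
  · exact le_of_eq (SimpleGraph.edist_eq_one_iff_adj.2 ((SimpleGraph.fromEdgeSet_adj E).2 ⟨h, hxy⟩))

theorem edist_fromEdgeSet_le_one_of_mem {x y : V} {e : Sym2 V} (he : e ∈ E) (hx : x ∈ e)
    (hy : y ∈ e) : (SimpleGraph.fromEdgeSet E).edist x y ≤ 1 := by
  by_cases hxy : x = y
  · subst hxy; simp
  · exact edist_fromEdgeSet_le_one ((Sym2.mem_and_mem_iff hxy).1 ⟨hx, hy⟩ ▸ he)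

theorem edist_le_add {G : SimpleGraph V} {x y z : V} {i j k : ℕ} (h1 : G.edist x y ≤ i)
    (h2 : G.edist y z ≤ j) (hk : i + j ≤ k) : G.edist x z ≤ k :=
  SimpleGraph.edist_triangle.trans ((add_le_add h1 h2).trans (by exact_mod_cast hk))

theorem SimpleGraph.Walk.lipschitz_le {G : SimpleGraph V} {φ : V → ℕ}
    (hφ : ∀ u v, G.Adj u v → φ u ≤ φ v + 1) {x y : V} (w : G.Walk x y) :
    φ x ≤ φ y + w.length := by
  induction w with
  | nil => simp
  | cons h p ih => have := hφ _ _ h; rw [SimpleGraph.Walk.length_cons]; omega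

theorem lipschitz_le_of_edgeSetDiam_le {G : SimpleGraph V} {d : ℕ} (hE : E ⊆ G.edgeSet)
    (hd : edgeSetDiam E ≤ d) {e f : Sym2 V} (he : e ∈ E) (hf : f ∈ E) {x y : V} (hx : x ∈ e)
    (hy : y ∈ f) {φ : V → ℕ} (hφ : ∀ u v, G.Adj u v → φ u ≤ φ v + 1) : φ x ≤ φ y + d := by
  have h1 : ((SimpleGraph.fromEdgeSet E).induce {v : V | ∃ e ∈ E, v ∈ e}).edist
      ⟨x, e, he, hx⟩ ⟨y, f, hf, hy⟩ ≤ d := SimpleGraph.edist_le_ediam.trans hd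
  obtain ⟨w, hw⟩ := SimpleGraph.exists_walk_of_edist_ne_top
    (ne_top_of_le_ne_top (ENat.natCast_ne_top d) h1)
  rw [← hw] at h1
  have h2 := SimpleGraph.Walk.lipschitz_le (φ := fun v => φ v.1) (fun u v huv => hφ u.1 v.1 (by
    have h3 := (SimpleGraph.fromEdgeSet_adj E).1 huv
    exact hE h3.1)) w
  have h3 : w.length ≤ d := by exact_mod_cast h1
  simp only at h2
  omega

end EdgeSetDiam

/-! ### Covers and the colourings they induce -/

section Covers

variable {V : Type*} {G : SimpleGraph V}

theorem HasLowDiamCover.mono_diam {d d' l : ℕ} (hd : d ≤ d') (h : HasLowDiamCover G d l) :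
    HasLowDiamCover G d' l := by
  obtain ⟨E, h1, h2⟩ := h
  exact ⟨E, h1, fun i => (h2 i).trans (by exact_mod_cast hd)⟩

theorem hasLowDiamCover_of_fintype {ι : Type*} [Fintype ι] {d l : ℕ} (hl : Fintype.card ι ≤ l)
    (E : ι → Set (Sym2 V)) (hE : ∀ i, E i ⊆ G.edgeSet) (hG : ∀ e ∈ G.edgeSet, ∃ i, e ∈ E i)
    (hd : ∀ i, edgeSetDiam (E i) ≤ d) : HasLowDiamCover G d l := by
  obtain ⟨f⟩ := Function.Embedding.nonempty_of_card_le (β := Fin l) (by simpa using hl)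
  -- Indices outside the range of `f` receive the empty set, of diameter 0.
  refine ⟨fun j => {e | ∃ i, f i = j ∧ e ∈ E i}, ?_, fun j => ?_⟩
  · ext e
    simp only [Set.mem_iUnion, Set.mem_ofPred_eq]
    constructor
    · intro he
      obtain ⟨i, hi⟩ := hG e he
      exact ⟨f i, i, rfl, hi⟩
    · rintro ⟨-, i, -, hi⟩
      exact hE i hi
  · by_cases h : ∃ i, f i = j
    · obtain ⟨i, rfl⟩ := h
      convert hd i using 2
      ext e
      simp
    · have h0 : {e | ∃ i, f i = j ∧ e ∈ E i} = (∅ : Set (Sym2 V)) := by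
        ext e
        simp only [Set.mem_ofPred_eq, Set.mem_empty_iff_false, iff_false]
        rintro ⟨i, hi, -⟩
        exact h ⟨i, hi⟩
      simp only [h0]
      exact edgeSetDiam_le (by simp)

theorem coverQ_le {n d l : ℕ} {ε : ℝ} (h : ∀ (G : SimpleGraph (Fin n)) [DecidableRel G.Adj],
    ε * (n : ℝ) ≤ (G.minDegree : ℝ) → HasLowDiamCover G d l) : coverQ n ε d ≤ l :=
  Nat.sInf_le h

theorem coverQ_anti_diam (n : ℕ) (ε : ℝ) {d d' : ℕ} (hd : 1 ≤ d) (hdd' : d ≤ d') :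
    coverQ n ε d' ≤ coverQ n ε d :=
  coverQ_le fun G _ hG => (coverQ_spec n ε hd G hG).mono_diam hdd'

/-- A low-diameter cover yields a colouring of the edges in which edges of equal colour are close
to each other, closeness being tested against `1`-Lipschitz functions. -/
theorem HasLowDiamCover.exists_coloring {d l : ℕ} (h : HasLowDiamCover G d l) :
    ∃ k : G.edgeSet → Fin l, ∀ e f : G.edgeSet, k e = k f → ∀ x ∈ e.1, ∀ y ∈ f.1, ∀ φ : V → ℕ,
      (∀ u v, G.Adj u v → φ u ≤ φ v + 1) → φ x ≤ φ y + d := by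
  obtain ⟨E, h1, h2⟩ := h
  have h3 : ∀ e : G.edgeSet, ∃ i, e.1 ∈ E i := fun e => by
    have h3 : e.1 ∈ ⋃ i, E i := h1.le e.2
    simpa using h3
  choose k hk using h3
  refine ⟨k, fun e f hef x hx y hy φ hφ => ?_⟩
  exact lipschitz_le_of_edgeSetDiam_le (h1 ▸ Set.subset_iUnion E (k e)) (h2 (k e)) (hk e)
    (hef ▸ hk f) hx hy hφ

end Covers

/-! ### Packing, greedy covering and balanced partitions -/

section Counting

theorem exists_maximal_pairwiseDisjoint {α β : Type*} [Finite α] [DecidableEq β]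
    (N : α → Finset β) (hN : ∀ a, (N a).Nonempty) :
    ∃ s : Finset α, (s : Set α).PairwiseDisjoint N ∧ ∀ a, ∃ b ∈ s, ¬ Disjoint (N a) (N b) := by
  classical
  have := Fintype.ofFinite α
  obtain ⟨s, hs⟩ := (Set.toFinite {s : Finset α | (s : Set α).PairwiseDisjoint N}).exists_maximal
    ⟨∅, by simp⟩
  refine ⟨s, hs.prop, fun a => ?_⟩
  by_contra! h
  have h1 : ((insert a s : Finset α) : Set α).PairwiseDisjoint N := by
    rw [Finset.coe_insert]
    exact hs.prop.insert fun b hb _ => h b hb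
  -- By maximality `a` is already in `s`; it then meets itself, because `N a` is nonempty.
  have h2 : a ∈ s := hs.le_of_ge h1 (Finset.subset_insert a s) (Finset.mem_insert_self a s)
  exact (hN a).ne_empty (disjoint_self.1 (h a h2))

theorem card_mul_le_of_pairwiseDisjoint {α β : Type*} [Fintype β] [DecidableEq β]
    {N : α → Finset β} {s : Finset α} (hs : (s : Set α).PairwiseDisjoint N) {m : ℝ}
    (hm : ∀ a, m ≤ (N a).card) : s.card * m ≤ Fintype.card β := by
  have h1 : (s.biUnion N).card ≤ Fintype.card β := Finset.card_le_univ _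
  rw [Finset.card_biUnion hs] at h1
  calc s.card * m = ∑ _a ∈ s, m := by simp
    _ ≤ ∑ a ∈ s, ((N a).card : ℝ) := Finset.sum_le_sum fun a _ => hm a
    _ ≤ _ := by exact_mod_cast h1

-- Averaging over `β`: some `b` serves at least a fraction `δ` of the elements not yet served, so
-- each choice multiplies their number by at most `1 - δ`.
open Classical in
theorem exists_greedy_cover {α β : Type*} [Fintype β] [Nonempty β] (R : α → β → Prop)
    (s : Finset α) {δ : ℝ} (h1δ : δ ≤ 1)
    (h : ∀ a ∈ s, δ * Fintype.card β ≤ (Finset.univ.filter (R a)).card) (L : ℕ) :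
    ∃ f : Fin L → β,
      ((s.filter fun a => ∀ i, ¬ R a (f i)).card : ℝ) ≤ (1 - δ) ^ L * s.card := by
  induction L with
  | zero => exact ⟨Fin.elim0, by simp⟩
  | succ L ih =>
    obtain ⟨f, hf⟩ := ih
    set t := s.filter fun a => ∀ i, ¬ R a (f i) with ht
    have key : ∃ b : β, δ * t.card ≤ ((t.filter fun a => R a b).card : ℝ) := by
      have hsum : ∑ _b : β, δ * (t.card : ℝ) ≤ ∑ b : β, ((t.filter fun a => R a b).card : ℝ) := by
        have h1 : ∑ b : β, (t.filter fun a => R a b).card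
            = ∑ a ∈ t, (Finset.univ.filter (R a)).card := by
          simp only [Finset.card_filter]
          exact Finset.sum_comm
        have h2 : ∑ b : β, ((t.filter fun a => R a b).card : ℝ)
            = ∑ a ∈ t, ((Finset.univ.filter (R a)).card : ℝ) := by exact_mod_cast h1
        rw [h2]
        calc ∑ _b : β, δ * (t.card : ℝ) = ∑ _a ∈ t, δ * Fintype.card β := by
              simp; ring
          _ ≤ _ := Finset.sum_le_sum fun a ha => h a (Finset.mem_filter.1 ha).1
      obtain ⟨b, -, hb⟩ := Finset.exists_le_of_sum_le Finset.univ_nonempty hsum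
      exact ⟨b, hb⟩
    obtain ⟨b, hb⟩ := key
    refine ⟨Fin.snoc f b, ?_⟩
    have h3 : (s.filter fun a => ∀ i, ¬ R a ((Fin.snoc f b : Fin (L + 1) → β) i))
        = t.filter fun a => ¬ R a b := by
      ext a
      simp [ht, Fin.forall_fin_succ', and_assoc]
    have h4 : ((t.filter fun a => R a b).card : ℝ) + (t.filter fun a => ¬ R a b).card = t.card := by
      exact_mod_cast Finset.card_filter_add_card_filter_not (s := t) (fun a => R a b)
    rw [h3]
    calc ((t.filter fun a => ¬ R a b).card : ℝ) ≤ (1 - δ) * t.card := by linarith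
      _ ≤ (1 - δ) * ((1 - δ) ^ L * s.card) := mul_le_mul_of_nonneg_left hf (by linarith)
      _ = _ := by ring

theorem exists_balanced_map (N : ℕ) (κ : Type*) [Fintype κ] [DecidableEq κ] [Nonempty κ] :
    ∃ f : Fin N → κ, ∀ c, N / Fintype.card κ ≤ (Finset.univ.filter fun i => f i = c).card := by
  have hpos : 0 < Fintype.card κ := Fintype.card_pos
  let e := Fintype.equivFin κ
  refine ⟨fun i => e.symm ⟨i % Fintype.card κ, Nat.mod_lt _ hpos⟩, fun c => ?_⟩
  have h1 := Nat.count_modEq_card N hpos (e c)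
  rw [Nat.count_eq_card_filter_range] at h1
  have h2 : N / Fintype.card κ
      ≤ ((Finset.range N).filter fun x => x ≡ e c [MOD Fintype.card κ]).card := by omega
  refine h2.trans (Finset.card_le_card_of_surjOn (fun i => (i : ℕ)) ?_)
  intro x hx
  simp only [Finset.coe_filter, Finset.mem_range, Set.mem_ofPred_eq] at hx
  refine ⟨⟨x, hx.1⟩, ?_, rfl⟩
  simp only [Finset.coe_filter, Finset.mem_univ, true_and, Set.mem_ofPred_eq]
  rw [Equiv.symm_apply_eq]
  ext
  have := hx.2
  unfold Nat.ModEq at this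
  rw [Nat.mod_eq_of_lt (e c).2] at this
  exact this

end Counting

/-! ### Upper bounds for diameters 6, 5 and 3 -/

section UpperBounds

variable {V : Type*}

/-- The edges of `G` with an endpoint that is equal to `v` or has a common neighbour with `v`. -/
def edgesNear (G : SimpleGraph V) (v : V) : Set (Sym2 V) :=
  {e ∈ G.edgeSet | ∃ y ∈ e, ∃ z, G.Adj v z ∧ G.Adj y z}

theorem edgeSetDiam_edgesNear_le (G : SimpleGraph V) (v : V) :
    edgeSetDiam (edgesNear G v) ≤ (6 : ℕ) := by
  have key : ∀ x, (∃ e ∈ edgesNear G v, x ∈ e) →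
      (SimpleGraph.fromEdgeSet (edgesNear G v)).edist v x ≤ (3 : ℕ) := by
    rintro x ⟨e, he, hx⟩
    obtain ⟨-, y, hy, z, hvz, hyz⟩ := id he
    have h1 := edist_fromEdgeSet_le_one_of_mem he hy hx
    have h2 : s(z, y) ∈ edgesNear G v := ⟨hyz.symm, y, by simp, z, hvz, hyz⟩
    have h3 : s(v, z) ∈ edgesNear G v := ⟨hvz, v, by simp, z, hvz, hvz⟩
    exact edist_le_add (edist_le_add (edist_fromEdgeSet_le_one h3) (edist_fromEdgeSet_le_one h2)
      (i := 1) (j := 1) le_rfl) (j := 1) h1 (by norm_num)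
  refine edgeSetDiam_le fun x y hx hy => edist_le_add (i := 3) (j := 3) ?_ (key y hy) (by norm_num)
  rw [SimpleGraph.edist_comm]
  exact key x hx

/-- The edges of `G` that have an endpoint adjacent to `u` or to `v`, or that join a vertex having
a common neighbour with `u` to a vertex having a common neighbour with `v`. -/
def edgesNearDart (G : SimpleGraph V) (u v : V) : Set (Sym2 V) :=
  {e ∈ G.edgeSet | (∃ z ∈ e, G.Adj u z ∨ G.Adj v z) ∨
    ∃ x y, e = s(x, y) ∧ (∃ z, G.Adj u z ∧ G.Adj x z) ∧ ∃ z, G.Adj v z ∧ G.Adj y z}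

/-- Every vertex is within 2 of `u` or of `v`, and the edge `uv` adds 1. The edges at neighbours of
`u` and `v` belong to the set so that these short paths stay inside it. -/
theorem edgeSetDiam_edgesNearDart_le {G : SimpleGraph V} {u v : V} (huv : G.Adj u v) :
    edgeSetDiam (edgesNearDart G u v) ≤ (5 : ℕ) := by
  have hadj : ∀ c, c = u ∨ c = v → ∀ x z, G.Adj c z → G.Adj x z →
      (SimpleGraph.fromEdgeSet (edgesNearDart G u v)).edist c x ≤ (2 : ℕ) := by
    intro c hc x z hcz hxz
    have hz : G.Adj u z ∨ G.Adj v z := by rcases hc with rfl | rfl <;> simp [hcz]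
    have h1 : s(c, z) ∈ edgesNearDart G u v := ⟨hcz, Or.inl ⟨z, by simp, hz⟩⟩
    have h2 : s(z, x) ∈ edgesNearDart G u v := ⟨hxz.symm, Or.inl ⟨z, by simp, hz⟩⟩
    exact edist_le_add (i := 1) (j := 1) (edist_fromEdgeSet_le_one h1)
      (edist_fromEdgeSet_le_one h2) le_rfl
  have key : ∀ x, (∃ e ∈ edgesNearDart G u v, x ∈ e) → ∃ c, (c = u ∨ c = v) ∧
      (SimpleGraph.fromEdgeSet (edgesNearDart G u v)).edist c x ≤ (2 : ℕ) := by
    rintro x ⟨e, he, hx⟩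
    rcases he.2 with ⟨z, hz, h⟩ | ⟨a, b, rfl, ⟨z, hz, haz⟩, w, hw, hbw⟩
    · obtain ⟨c, hc, hcz⟩ : ∃ c, (c = u ∨ c = v) ∧ G.Adj c z := by
        rcases h with h | h
        exacts [⟨u, by simp, h⟩, ⟨v, by simp, h⟩]
      have h1 : s(c, z) ∈ edgesNearDart G u v := ⟨hcz, Or.inl ⟨z, by simp, h⟩⟩
      exact ⟨c, hc, edist_le_add (i := 1) (j := 1) (edist_fromEdgeSet_le_one h1)
        (edist_fromEdgeSet_le_one_of_mem he hz hx) le_rfl⟩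
    · rcases Sym2.mem_iff.1 hx with rfl | rfl
      · exact ⟨u, by simp, hadj u (by simp) x z hz haz⟩
      · exact ⟨v, by simp, hadj v (by simp) x w hw hbw⟩
  have hcc : ∀ c c', (c = u ∨ c = v) → (c' = u ∨ c' = v) →
      (SimpleGraph.fromEdgeSet (edgesNearDart G u v)).edist c c' ≤ (1 : ℕ) := by
    have h1 : s(u, v) ∈ edgesNearDart G u v := ⟨huv, Or.inl ⟨v, by simp, Or.inl huv⟩⟩
    intro c c' hc hc'
    exact edist_fromEdgeSet_le_one_of_mem h1 (Sym2.mem_iff.2 hc) (Sym2.mem_iff.2 hc')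
  refine edgeSetDiam_le fun x y hx hy => ?_
  obtain ⟨c, hc, hcx⟩ := key x hx
  obtain ⟨c', hc', hcy⟩ := key y hy
  rw [SimpleGraph.edist_comm] at hcx
  exact edist_le_add (edist_le_add hcx (hcc c c' hc hc') le_rfl) hcy le_rfl

/-- The edges between the neighbourhoods of `a` and `b`, joined to `a` and `b`. -/
def doubleStar (G : SimpleGraph V) (a b : V) : Set (Sym2 V) :=
  {e | ∃ x y, (G.Adj a x ∧ G.Adj b y ∧ G.Adj x y) ∧ (e = s(x, y) ∨ e = s(a, x) ∨ e = s(b, y))}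

theorem doubleStar_subset (G : SimpleGraph V) (a b : V) : doubleStar G a b ⊆ G.edgeSet := by
  rintro e ⟨x, y, ⟨h1, h2, h3⟩, rfl | rfl | rfl⟩ <;> assumption

/-- Any two vertices are joined through a centre: for instance `x`, `a`, `x'`, `y'`, and `a`, `x`,
`y`, `b` for the two centres. -/
theorem edgeSetDiam_doubleStar_le (G : SimpleGraph V) (a b : V) :
    edgeSetDiam (doubleStar G a b) ≤ (3 : ℕ) := by
  set F := SimpleGraph.fromEdgeSet (doubleStar G a b) with hF
  have hxy : ∀ {x y}, G.Adj a x ∧ G.Adj b y ∧ G.Adj x y → F.edist x y ≤ (1 : ℕ) :=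
    fun {x y} h => edist_fromEdgeSet_le_one ⟨x, y, h, by simp⟩
  have hax : ∀ {x y}, G.Adj a x ∧ G.Adj b y ∧ G.Adj x y → F.edist a x ≤ (1 : ℕ) :=
    fun {x y} h => edist_fromEdgeSet_le_one ⟨x, y, h, by simp⟩
  have hby : ∀ {x y}, G.Adj a x ∧ G.Adj b y ∧ G.Adj x y → F.edist b y ≤ (1 : ℕ) :=
    fun {x y} h => edist_fromEdgeSet_le_one ⟨x, y, h, by simp⟩
  have hyx : ∀ {x y}, G.Adj a x ∧ G.Adj b y ∧ G.Adj x y → F.edist y x ≤ (1 : ℕ) :=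
    fun {x y} h => by rw [SimpleGraph.edist_comm]; exact hxy h
  have hxa : ∀ {x y}, G.Adj a x ∧ G.Adj b y ∧ G.Adj x y → F.edist x a ≤ (1 : ℕ) :=
    fun {x y} h => by rw [SimpleGraph.edist_comm]; exact hax h
  have hyb : ∀ {x y}, G.Adj a x ∧ G.Adj b y ∧ G.Adj x y → F.edist y b ≤ (1 : ℕ) :=
    fun {x y} h => by rw [SimpleGraph.edist_comm]; exact hby h
  have key : ∀ w, (∃ e ∈ doubleStar G a b, w ∈ e) → ∃ x y,
      (G.Adj a x ∧ G.Adj b y ∧ G.Adj x y) ∧ (w = x ∨ w = y ∨ w = a ∨ w = b) := by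
    rintro w ⟨e, ⟨x, y, h, rfl | rfl | rfl⟩, hw⟩ <;> rcases Sym2.mem_iff.1 hw with rfl | rfl
    exacts [⟨w, y, h, by simp⟩, ⟨x, w, h, by simp⟩, ⟨x, y, h, by simp⟩, ⟨w, y, h, by simp⟩,
      ⟨x, y, h, by simp⟩, ⟨x, w, h, by simp⟩]
  have two : ∀ {i j k}, F.edist i j ≤ (1 : ℕ) → F.edist j k ≤ (1 : ℕ) → F.edist i k ≤ (3 : ℕ) :=
    fun h h' => edist_le_add h h' (by norm_num)
  have three : ∀ {i j k l}, F.edist i j ≤ (1 : ℕ) → F.edist j k ≤ (1 : ℕ) →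
      F.edist k l ≤ (1 : ℕ) → F.edist i l ≤ (3 : ℕ) :=
    fun h h' h'' => edist_le_add (edist_le_add h h' (le_refl (1 + 1))) h'' le_rfl
  have one : ∀ {i j}, F.edist i j ≤ (1 : ℕ) → F.edist i j ≤ (3 : ℕ) :=
    fun h => h.trans (by norm_num)
  refine edgeSetDiam_le fun w w' hw hw' => ?_
  obtain ⟨x, y, h, h1⟩ := key w hw
  obtain ⟨x', y', h', h1'⟩ := key w' hw'
  rcases h1 with rfl | rfl | rfl | rfl <;> rcases h1' with rfl | rfl | rfl | rfl
  · exact two (hxa h) (hax h')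
  · exact three (hxy h) (hyb h) (hby h')
  · exact one (hxa h)
  · exact two (hxy h) (hyb h)
  · exact three (hyx h) (hxa h) (hax h')
  · exact two (hyb h) (hby h')
  · exact two (hyx h) (hxa h)
  · exact one (hyb h)
  · exact one (hax h')
  · exact two (hax h') (hxy h')
  · simp
  · exact three (hax h) (hxy h) (hyb h)
  · exact two (hby h') (hyx h')
  · exact one (hby h')
  · exact three (hby h) (hyx h) (hxa h)
  · simp

theorem mul_le_card_neighborFinset {n : ℕ} {ε : ℝ} {G : SimpleGraph (Fin n)} [DecidableRel G.Adj]
    (hG : ε * (n : ℝ) ≤ (G.minDegree : ℝ)) (v : Fin n) :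
    ε * (n : ℝ) ≤ (G.neighborFinset v).card := by
  rw [SimpleGraph.card_neighborFinset_eq_degree]
  exact hG.trans (by exact_mod_cast G.minDegree_le_degree v)

theorem coverQ_six_le (n : ℕ) {ε : ℝ} (hε : 0 < ε) : (coverQ n ε 6 : ℝ) ≤ 1 / ε := by
  refine (Nat.cast_le.2 (coverQ_le (l := ⌊1 / ε⌋₊) fun G _ hG => ?_)).trans
    (Nat.floor_le (by positivity))
  rcases Nat.eq_zero_or_pos n with rfl | hn
  · refine hasLowDiamCover_of_fintype (ι := Fin 0) (by simp) (fun _ => ∅) (by simp) ?_ (by simp)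
    intro e
    induction e with | _ x y => exact x.elim0
  have hn' : (0 : ℝ) < n := by exact_mod_cast hn
  have hdeg := mul_le_card_neighborFinset hG
  have hne : ∀ v, (G.neighborFinset v).Nonempty := fun v => by
    rw [← Finset.card_pos]
    have : (0 : ℝ) < (G.neighborFinset v).card := (by positivity : 0 < ε * n).trans_le (hdeg v)
    exact_mod_cast this
  obtain ⟨s, hs, hmax⟩ := exists_maximal_pairwiseDisjoint (fun v => G.neighborFinset v) hne
  have hcard := card_mul_le_of_pairwiseDisjoint hs hdeg
  rw [Fintype.card_fin] at hcard
  refine hasLowDiamCover_of_fintype (ι := s) ?_ (fun v => edgesNear G v.1)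
    (fun v => Set.sep_subset _ _) ?_ (fun v => edgeSetDiam_edgesNear_le G v.1)
  · rw [Fintype.card_coe]
    refine Nat.le_floor ?_
    rw [le_div_iff₀ hε]
    nlinarith
  · intro e
    induction e with | _ x y => ?_
    intro he
    obtain ⟨v, hv, hd⟩ := hmax x
    obtain ⟨z, hz1, hz2⟩ := Finset.not_disjoint_iff.1 hd
    rw [SimpleGraph.mem_neighborFinset] at hz1 hz2
    exact ⟨⟨v, hv⟩, he, x, by simp, z, hz2, hz1⟩

theorem coverQ_five_le (n : ℕ) {ε : ℝ} (hε : 0 < ε) : (coverQ n ε 5 : ℝ) ≤ 1 / ε ^ 2 := by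
  refine (Nat.cast_le.2 (coverQ_le (l := ⌊1 / ε ^ 2⌋₊) fun G _ hG => ?_)).trans
    (Nat.floor_le (by positivity))
  rcases Nat.eq_zero_or_pos n with rfl | hn
  · refine hasLowDiamCover_of_fintype (ι := Fin 0) (by simp) (fun _ => ∅) (by simp) ?_ (by simp)
    intro e
    induction e with | _ x y => exact x.elim0
  have hn' : (0 : ℝ) < n := by exact_mod_cast hn
  have hdeg := mul_le_card_neighborFinset hG
  let N : G.Dart → Finset (Fin n × Fin n) :=
    fun e => G.neighborFinset e.fst ×ˢ G.neighborFinset e.snd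
  have hN : ∀ e, (ε * n) * (ε * n) ≤ (N e).card := fun e => by
    rw [Finset.card_product]
    push_cast
    exact mul_le_mul (hdeg _) (hdeg _) (by positivity) (by positivity)
  have hne : ∀ e, (N e).Nonempty := fun e => by
    rw [← Finset.card_pos]
    have : (0 : ℝ) < (N e).card := (by positivity : 0 < (ε * n) * (ε * n)).trans_le (hN e)
    exact_mod_cast this
  obtain ⟨s, hs, hmax⟩ := exists_maximal_pairwiseDisjoint N hne
  have hcard := card_mul_le_of_pairwiseDisjoint hs hN
  rw [Fintype.card_prod, Fintype.card_fin] at hcard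
  push_cast at hcard
  refine hasLowDiamCover_of_fintype (ι := s) ?_ (fun e => edgesNearDart G e.1.fst e.1.snd)
    (fun v => Set.sep_subset _ _) ?_ (fun e => edgeSetDiam_edgesNearDart_le e.1.adj)
  · rw [Fintype.card_coe]
    refine Nat.le_floor ?_
    rw [le_div_iff₀ (by positivity)]
    have : (s.card * ε ^ 2) * ((n : ℝ) * n) ≤ 1 * ((n : ℝ) * n) := by linarith
    exact le_of_mul_le_mul_right this (by positivity)
  · intro e
    induction e with | _ x y => ?_
    intro he
    obtain ⟨d, hd, hdis⟩ := hmax ⟨(x, y), he⟩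
    obtain ⟨⟨z, w⟩, hz1, hz2⟩ := Finset.not_disjoint_iff.1 hdis
    simp only [N, Finset.mem_product, SimpleGraph.mem_neighborFinset] at hz1 hz2
    exact ⟨⟨d, hd⟩, he, Or.inr ⟨x, y, rfl, ⟨z, hz2.1, hz1.1⟩, w, hz2.2, hz1.2⟩⟩

theorem coverQ_three_le {n : ℕ} (hn : 1 ≤ n) {ε : ℝ} (hε : 0 < ε) (hε1 : ε ≤ 1) :
    (coverQ n ε 3 : ℝ) ≤ 2 * Real.log n / ε ^ 2 + 2 := by
  have hn' : (1 : ℝ) ≤ n := by exact_mod_cast hn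
  have hlog := Real.log_nonneg hn'
  set L := ⌊2 * Real.log n / ε ^ 2⌋₊ + 1 with hL
  have hL1 : (L : ℝ) ≤ 2 * Real.log n / ε ^ 2 + 2 := by
    have := Nat.floor_le (by positivity : 0 ≤ 2 * Real.log n / ε ^ 2)
    rw [hL]; push_cast; linarith
  have hL2 : 2 * Real.log n / ε ^ 2 < L := by
    rw [hL]; push_cast; exact Nat.lt_floor_add_one _
  refine (Nat.cast_le.2 (coverQ_le (l := L) fun G _ hG => ?_)).trans hL1
  classical
  have hdeg := mul_le_card_neighborFinset hG
  have : Nonempty (Fin n × Fin n) := ⟨(⟨0, hn⟩, ⟨0, hn⟩)⟩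
  obtain ⟨R, hR⟩ : ∃ R : Fin n × Fin n → Fin n × Fin n → Prop,
      ∀ e p, R e p ↔ G.Adj e.1 p.1 ∧ G.Adj e.2 p.2 := ⟨_, fun _ _ => Iff.rfl⟩
  obtain ⟨f, hf⟩ := exists_greedy_cover R Finset.univ (δ := ε ^ 2)
    (by nlinarith) (fun e _ => by
      have h1 : Finset.univ.filter (R e)
          = G.neighborFinset e.1 ×ˢ G.neighborFinset e.2 := by
        ext p; simp [hR]
      rw [h1, Finset.card_product, Fintype.card_prod, Fintype.card_fin]
      push_cast
      calc ε ^ 2 * ((n : ℝ) * n) = (ε * n) * (ε * n) := by ring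
        _ ≤ _ := mul_le_mul (hdeg _) (hdeg _) (by positivity) (by positivity)) L
  -- With `L > 2 log n / ε²` fewer than `n² exp(-ε² L) < 1` pairs stay unserved, hence none.
  have hlt : (1 - ε ^ 2) ^ L * ((Finset.univ : Finset (Fin n × Fin n)).card : ℝ) < 1 := by
    rw [Finset.card_univ, Fintype.card_prod, Fintype.card_fin]
    push_cast
    have h2 : (1 - ε ^ 2) ^ L ≤ Real.exp (-(ε ^ 2 * L)) := by
      calc (1 - ε ^ 2) ^ L ≤ (Real.exp (-ε ^ 2)) ^ L :=
            pow_le_pow_left₀ (by nlinarith) (by have := Real.add_one_le_exp (-ε ^ 2); linarith) L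
        _ = _ := by rw [← Real.exp_nat_mul]; congr 1; ring
    have h3 : Real.exp (-(ε ^ 2 * L)) < Real.exp (-(2 * Real.log n)) := by
      rw [Real.exp_lt_exp]
      rw [div_lt_iff₀ (by positivity)] at hL2
      linarith
    have h4 : Real.exp (-(2 * Real.log n)) * ((n : ℝ) * n) = 1 := by
      rw [Real.exp_neg, two_mul, Real.exp_add, Real.exp_log (by positivity)]
      field_simp
    calc _ < Real.exp (-(2 * Real.log n)) * ((n : ℝ) * n) :=
          mul_lt_mul_of_pos_right (h2.trans_lt h3) (by positivity)
      _ = 1 := h4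
  have h0 := hf.trans_lt hlt
  rw [Nat.cast_lt_one, Finset.card_eq_zero, Finset.filter_eq_empty_iff] at h0
  refine hasLowDiamCover_of_fintype (ι := Fin L) (by simp)
    (fun i => doubleStar G (f i).1 (f i).2) (fun i => doubleStar_subset _ _ _) ?_
    (fun i => edgeSetDiam_doubleStar_le _ _ _)
  intro e
  induction e with | _ x y => ?_
  intro he
  have h1 := h0 (Finset.mem_univ (x, y))
  simp only [hR] at h1
  push Not at h1
  obtain ⟨i, hi1, hi2⟩ := h1
  exact ⟨i, x, y, ⟨hi1.symm, hi2.symm, he⟩, by simp⟩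

end UpperBounds

/-! ### Lower bounds through colourings; disjoint cliques -/

section Transfer

theorem hasLowDiamCover_coverQ {n d : ℕ} {ε : ℝ} (hd : 1 ≤ d) (hn : 0 < n)
    (G : SimpleGraph (Fin n))
    (h : ∀ v, ∃ s : Finset (Fin n), (∀ w ∈ s, G.Adj v w) ∧ ε * n ≤ s.card) :
    HasLowDiamCover G d (coverQ n ε d) := by
  classical
  refine coverQ_spec n ε hd G ?_
  have : Nonempty (Fin n) := ⟨⟨0, hn⟩⟩
  obtain ⟨v, hv⟩ := G.exists_minimal_degree_vertex
  obtain ⟨s, hs, hc⟩ := h v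
  rw [hv, ← SimpleGraph.card_neighborFinset_eq_degree]
  refine hc.trans (Nat.cast_le.2 (Finset.card_le_card fun w hw => ?_))
  simpa using hs w hw

/-- Moves the graph to any vertex type of size `n` and keeps only a chosen family of edges `x p`–`y
p`, the ones on which the lower bounds count colours. -/
theorem exists_coloring_coverQ {n d : ℕ} {ε : ℝ} (hd : 1 ≤ d) (hn : 0 < n) {X P : Type*}
    [Fintype X] (hX : Fintype.card X = n) (G : SimpleGraph X)
    (h : ∀ v, ∃ s : Finset X, (∀ w ∈ s, G.Adj v w) ∧ ε * n ≤ s.card)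
    (x y : P → X) (hxy : ∀ p, G.Adj (x p) (y p)) :
    ∃ k : P → Fin (coverQ n ε d), ∀ p p', k p = k p' → ∀ φ : X → ℕ,
      (∀ u v, G.Adj u v → φ u ≤ φ v + 1) →
        φ (x p) ≤ φ (x p') + d ∧ φ (y p) ≤ φ (y p') + d ∧ φ (y p) ≤ φ (x p') + d := by
  let e : Fin n ≃ X := (Fintype.equivFinOfCardEq hX).symm
  have hcov : HasLowDiamCover (G.comap e) d (coverQ n ε d) := by
    refine hasLowDiamCover_coverQ hd hn _ fun v => ?_
    obtain ⟨s, hs, hc⟩ := h (e v)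
    refine ⟨s.map e.symm.toEmbedding, fun w hw => ?_, by rwa [Finset.card_map]⟩
    obtain ⟨u, hu, rfl⟩ := Finset.mem_map.1 hw
    simpa using hs u hu
  obtain ⟨k, hk⟩ := hcov.exists_coloring
  have hadj : ∀ p, s(e.symm (x p), e.symm (y p)) ∈ (G.comap e).edgeSet := fun p => by
    simpa using hxy p
  refine ⟨fun p => k ⟨_, hadj p⟩, fun p p' hpp' φ hφ => ?_⟩
  have := fun u hu v hv => hk ⟨_, hadj p⟩ ⟨_, hadj p'⟩ hpp' u hu v hv
    (fun v => φ (e v)) (fun u v huv => hφ _ _ huv)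
  exact ⟨by simpa using this (e.symm (x p)) (by simp) (e.symm (x p')) (by simp),
    by simpa using this (e.symm (y p)) (by simp) (e.symm (y p')) (by simp),
    by simpa using this (e.symm (y p)) (by simp) (e.symm (x p')) (by simp)⟩

theorem card_le_coverQ_of_cliques {n d m : ℕ} {ε : ℝ} (hd : 1 ≤ d) (hn : 0 < n) (hm : 0 < m)
    (hε : ε * n + 1 ≤ (n / m : ℕ)) (hε0 : 0 < ε) : m ≤ coverQ n ε d := by
  have : Nonempty (Fin m) := ⟨⟨0, hm⟩⟩
  obtain ⟨f, hf⟩ := exists_balanced_map n (Fin m)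
  rw [Fintype.card_fin] at hf
  let G : SimpleGraph (Fin n) := {
    Adj := fun u v => u ≠ v ∧ f u = f v
    symm := ⟨fun u v h => ⟨h.1.symm, h.2.symm⟩⟩
    loopless := ⟨fun u h => h.1 rfl⟩ }
  have hdeg : ∀ v, ∃ s : Finset (Fin n), (∀ w ∈ s, G.Adj v w) ∧ ε * n ≤ s.card := by
    intro v
    refine ⟨(Finset.univ.filter fun i => f i = f v).erase v, fun w hw => ?_, ?_⟩
    · simp only [Finset.mem_erase, Finset.mem_filter, Finset.mem_univ, true_and] at hw
      exact ⟨hw.1.symm, hw.2.symm⟩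
    · rw [Finset.cast_card_erase_of_mem (by simp)]
      have : ((n / m : ℕ) : ℝ) ≤ (Finset.univ.filter fun i => f i = f v).card := by
        exact_mod_cast hf (f v)
      linarith
  have hpair : ∀ c, ∃ x y, G.Adj x y ∧ f x = c := by
    intro c
    have h1 : 1 < (Finset.univ.filter fun i => f i = c).card := by
      have h2 : ((n / m : ℕ) : ℝ) ≤ (Finset.univ.filter fun i => f i = c).card := by
        exact_mod_cast hf c
      have h3 : (0 : ℝ) < ε * n := by positivity
      have h4 : (1 : ℝ) < (Finset.univ.filter fun i => f i = c).card := by linarith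
      exact_mod_cast h4
    obtain ⟨x, hx, y, hy, hxy⟩ := Finset.one_lt_card.1 h1
    simp only [Finset.mem_filter, Finset.mem_univ, true_and] at hx hy
    exact ⟨x, y, ⟨hxy, hx.trans hy.symm⟩, hx⟩
  choose x y hxy hx using hpair
  obtain ⟨k, hk⟩ := exists_coloring_coverQ (d := d) hd hn (Fintype.card_fin n) G hdeg x y hxy
  have hinj : Function.Injective k := by
    intro c c' hcc'
    by_contra hne
    -- No edge joins different cliques, so a function that is 0 on one clique and `d + 1` on the
    -- others is Lipschitz.
    have := (hk c c' hcc' (fun v => if f v = c' then 0 else d + 1) (fun u v huv => by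
      have := huv.2
      simp [this])).1
    simp [hx, hne] at this
  simpa using Fintype.card_le_of_injective k hinj

end Transfer

/-! ### Colouring arguments on the shift graph -/

section Shift

/-- The pairs `x < y` in `Fin q`. -/
abbrev IncPair (q : ℕ) : Type := {s : Fin q × Fin q // s.1 < s.2}

/-- The classical bound for the shift graph, for a family of colourings at once: record for each `x`
and `b` the set of colours on pairs starting at `x`. Two points `x < y` have equal records, so the
colour of `(x, y)` recurs on a pair starting at `y`. -/
theorem exists_shift {B K : Type*} [Fintype B] [Fintype K] {q : ℕ}
    (h : 2 ^ (Fintype.card K * Fintype.card B) < q) (c : B → IncPair q → K) :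
    ∃ x y, ∃ hxy : x < y, ∀ b, ∃ z, ∃ hyz : y < z, c b ⟨(y, z), hyz⟩ = c b ⟨(x, y), hxy⟩ := by
  classical
  let C : Fin q → B → Finset K := fun x b =>
    Finset.univ.filter fun i => ∃ z, ∃ h : x < z, c b ⟨(x, z), h⟩ = i
  obtain ⟨x, y, hne, hC⟩ := Fintype.exists_ne_map_eq_of_card_lt C (by
    simpa [pow_mul] using h)
  have key : ∀ x y, C x = C y → ∀ hxy : x < y, ∀ b, ∃ z, ∃ hyz : y < z,
      c b ⟨(y, z), hyz⟩ = c b ⟨(x, y), hxy⟩ := by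
    intro x y hC hxy b
    have h1 : c b ⟨(x, y), hxy⟩ ∈ C x b := by
      simp only [C, Finset.mem_filter, Finset.mem_univ, true_and]
      exact ⟨y, hxy, rfl⟩
    rw [hC] at h1
    simpa only [C, Finset.mem_filter, Finset.mem_univ, true_and] using h1
  rcases lt_or_gt_of_ne hne with hlt | hlt
  · exact ⟨x, y, hlt, key x y hC hlt⟩
  · exact ⟨y, x, hlt, key y x hC.symm hlt⟩

theorem le_two_pow_of_coloring {q l : ℕ} {R : IncPair q → IncPair q → Prop}
    (hR : ∀ x y z, ∀ (hxy : x < y) (hyz : y < z), ¬ R ⟨(x, y), hxy⟩ ⟨(y, z), hyz⟩)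
    (k : IncPair q → Fin l) (hk : ∀ s s', k s = k s' → R s s') : q ≤ 2 ^ l := by
  by_contra! hlt
  obtain ⟨x, y, hxy, h⟩ := exists_shift (B := Unit) (K := Fin l) (by simpa using hlt)
    (fun _ => k)
  obtain ⟨z, hyz, hz⟩ := h ()
  exact hR x y z hxy hyz (hk _ _ hz.symm)

/-- The block `(a, b)` of the colouring `k` is filled with colours occurring only in row `a`. -/
def RowFull {κ F L : Type*} (k : (κ × κ) × (F × F) → L) (a b : κ) : Prop :=
  ∀ s, ∃ s', ∀ p, k p = k ((a, b), (s, s')) → p.1.1 = a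

-- Let `K a` be the colours confined to row `a`; these sets are disjoint. If row `a` had more full
-- blocks than such colours, take `x < y` from `exists_shift`, applied to all full blocks together.
-- By pigeonhole two of these blocks share a colour at `(x, y)`, and the second one repeats it at
-- some `(y, z)`, contradicting `hR`.
open Classical in
theorem sum_card_rowFull_le {r q l : ℕ} {R : IncPair q → IncPair q → Prop}
    (hR : ∀ x y z, ∀ (hxy : x < y) (hyz : y < z), ¬ R ⟨(x, y), hxy⟩ ⟨(y, z), hyz⟩)
    (hq : 2 ^ (r * r) < q) (k : (Fin r × Fin r) × (IncPair q × IncPair q) → Fin l)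
    (hk : ∀ p p', k p = k p' → p.1.2 ≠ p'.1.2 → R p.2.1 p'.2.1) :
    ∑ a, (Finset.univ.filter fun b => RowFull k a b).card ≤ l := by
  let K : Fin r → Finset (Fin l) := fun a =>
    Finset.univ.filter fun i => (∃ p, k p = i) ∧ ∀ p, k p = i → p.1.1 = a
  have hdisj : ((Finset.univ : Finset (Fin r)) : Set (Fin r)).PairwiseDisjoint K := by
    intro a _ a' _ hne
    refine Finset.disjoint_left.2 fun i hi hi' => hne ?_
    simp only [K, Finset.mem_filter, Finset.mem_univ, true_and] at hi hi'
    obtain ⟨p, hp⟩ := hi.1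
    exact (hi.2 p hp).symm.trans (hi'.2 p hp)
  have hrow : ∀ a, (Finset.univ.filter fun b => RowFull k a b).card ≤ (K a).card := by
    intro a
    by_contra! hlt
    set B := Finset.univ.filter fun b => RowFull k a b with hB
    have hBr : B.card ≤ r := by simpa using Finset.card_le_univ B
    have hfull : ∀ (b : B) s, ∃ s', ∀ p, k p = k ((a, b.1), (s, s')) → p.1.1 = a :=
      fun b s => (Finset.mem_filter.1 b.2).2 s
    choose g hg using hfull
    obtain ⟨x, y, hxy, h⟩ := exists_shift (B := B) (K := K a) (q := q) (by
      rw [Fintype.card_coe, Fintype.card_coe]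
      refine lt_of_le_of_lt (Nat.pow_le_pow_right (by norm_num) ?_) hq
      exact Nat.mul_le_mul (hlt.le.trans hBr) hBr)
      (fun b s => ⟨k ((a, b.1), (s, g b s)), by
        simp only [K, Finset.mem_filter, Finset.mem_univ, true_and]
        exact ⟨⟨_, rfl⟩, hg b s⟩⟩)
    simp only [Subtype.mk.injEq] at h
    obtain ⟨b, -, b', -, hne, hbb'⟩ := Finset.exists_ne_map_eq_of_card_lt_of_maps_to
      (s := (Finset.univ : Finset B)) (t := K a) (by simpa using hlt)
      (f := fun b : B => k ((a, b.1), (⟨(x, y), hxy⟩, g b ⟨(x, y), hxy⟩))) (by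
        intro b _
        simp only [K, Finset.coe_filter, Finset.mem_univ, true_and, Set.mem_ofPred_eq]
        exact ⟨⟨_, rfl⟩, hg b _⟩)
    obtain ⟨z, hyz, hz⟩ := h b'
    exact hR x y z hxy hyz (hk _ _ (hbb'.trans hz.symm) fun hb => hne (Subtype.ext hb))
  calc _ ≤ ∑ a, (K a).card := Finset.sum_le_sum fun a _ => hrow a
    _ = (Finset.univ.biUnion K).card := (Finset.card_biUnion hdisj).symm
    _ ≤ l := by simpa using Finset.card_le_univ (Finset.univ.biUnion K)

theorem mul_self_le_two_mul_of_coloring {r q l : ℕ} {R : IncPair q → IncPair q → Prop}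
    (hR : ∀ x y z, ∀ (hxy : x < y) (hyz : y < z), ¬ R ⟨(x, y), hxy⟩ ⟨(y, z), hyz⟩)
    (hq : 2 ^ (r * r) < q) (k : (Fin r × Fin r) × (IncPair q × IncPair q) → Fin l)
    (h1 : ∀ p p', k p = k p' → p.1.1 ≠ p'.1.1 → p.1.2 = p'.1.2 ∧ R p.2.2 p'.2.2)
    (h2 : ∀ p p', k p = k p' → p.1.2 ≠ p'.1.2 → p.1.1 = p'.1.1 ∧ R p.2.1 p'.2.1) :
    r * r ≤ 2 * l := by
  classical
  let k' : (Fin r × Fin r) × (IncPair q × IncPair q) → Fin l := fun p => k (p.1.swap, p.2.swap)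
  have hrow := sum_card_rowFull_le hR hq k fun p p' h h' => (h2 p p' h h').2
  have hcol := sum_card_rowFull_le hR hq k' fun p p' h h' => (h1 _ _ h h').2
  -- Otherwise the colour of one cell `(s, s')` of the block occurs outside row `a`, hence in column
  -- `b`, and also outside column `b`, hence in row `a`. These two occurrences differ in both row
  -- and column, which `h1` forbids.
  have hcase : ∀ a b, RowFull k a b ∨ RowFull k' b a := by
    intro a b
    by_contra! hcon
    obtain ⟨hr, hc⟩ := hcon
    unfold RowFull at hr hc
    push Not at hr hc
    obtain ⟨s, hs⟩ := hr
    obtain ⟨s', hs'⟩ := hc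
    obtain ⟨p, hp, hpa⟩ := hs s'
    obtain ⟨p', hp', hpb⟩ := hs' s
    have e1 := (h1 _ _ hp hpa).1
    have e2 := (h2 _ _ (show k (p'.1.swap, p'.2.swap) = k ((a, b), (s, s')) from hp') hpb).1
    have e3 := (h1 _ _ (hp.trans (show k (p'.1.swap, p'.2.swap) = k ((a, b), (s, s')) from hp').symm)
      (by rw [e2]; exact hpa)).1
    exact hpb (e3.symm.trans e1)
  have hswap : ∑ b, (Finset.univ.filter fun a => RowFull k' b a).card
      = ∑ a, (Finset.univ.filter fun b => RowFull k' b a).card := by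
    simp only [Finset.card_filter]
    exact Finset.sum_comm
  rw [hswap] at hcol
  calc r * r = ∑ _a : Fin r, r := by simp
    _ ≤ ∑ a, ((Finset.univ.filter fun b => RowFull k a b).card
        + (Finset.univ.filter fun b => RowFull k' b a).card) := by
        refine Finset.sum_le_sum fun a _ => ?_
        refine le_trans ?_ (Finset.card_union_le _ _)
        rw [← Finset.filter_or, Finset.filter_true_of_mem fun b _ => hcase a b]
        simp
    _ ≤ 2 * l := by rw [Finset.sum_add_distrib]; omega

end Shift

/-! ### Dense sets that are disjoint along shift edges -/

section Design

/-- Take `L` to be half of the field and `T (i, j)` the points `u` of the plane with `g i u ∈ L` and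
`g j u ∉ L`. Consecutive pairs disagree on whether `g y u ∈ L`. For `i ≠ j` the map `u ↦ (g i u, g j
u)` is a bijection, so `T (i, j)` has about a quarter of the points. -/
theorem exists_shift_design {q : ℕ} (hq : q.Prime) (hq3 : 3 ≤ q) :
    ∃ T : IncPair q → Finset (ZMod q × ZMod q), (∀ s, q * q ≤ 8 * (T s).card) ∧
      ∀ x y z, ∀ (hxy : x < y) (hyz : y < z), Disjoint (T ⟨(x, y), hxy⟩) (T ⟨(y, z), hyz⟩) := by
  have : Fact q.Prime := ⟨hq⟩
  obtain ⟨L, -, hL⟩ := Finset.exists_subset_card_eq (s := (Finset.univ : Finset (ZMod q)))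
    (n := q / 2) (by rw [Finset.card_univ, ZMod.card]; omega)
  let g : Fin q → ZMod q × ZMod q → ZMod q := fun i u => u.1 * ((i : ℕ) : ZMod q) + u.2
  refine ⟨fun s => Finset.univ.filter fun u => g s.1.1 u ∈ L ∧ g s.1.2 u ∉ L, ?_, ?_⟩
  · rintro ⟨⟨i, j⟩, hij⟩
    have hij' : ((i : ℕ) : ZMod q) - ((j : ℕ) : ZMod q) ≠ 0 := by
      rw [sub_ne_zero]
      intro h
      rw [ZMod.natCast_eq_natCast_iff] at h
      have := Nat.ModEq.eq_of_lt_of_lt h i.2 j.2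
      have h3 : (i : ℕ) < j := hij
      omega
    have hbij : Function.Bijective fun u : ZMod q × ZMod q => (g i u, g j u) := by
      rw [← Finite.injective_iff_bijective]
      rintro ⟨a, b⟩ ⟨a', b'⟩ h
      simp only [g, Prod.mk.injEq] at h
      have h1 : (a - a') * (((i : ℕ) : ZMod q) - ((j : ℕ) : ZMod q)) = 0 := by
        linear_combination h.1 - h.2
      have h2 : a = a' := sub_eq_zero.1 ((mul_eq_zero.1 h1).resolve_right hij')
      subst h2
      simpa using h.1
    have hcard : (Finset.univ.filter fun u => g i u ∈ L ∧ g j u ∉ L).card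
        = (L ×ˢ Lᶜ).card := by
      refine Finset.card_bij (fun u _ => (g i u, g j u)) ?_ (fun u _ v _ h => hbij.1 h) ?_
      · intro u hu
        simpa using hu
      · intro v hv
        obtain ⟨u, rfl⟩ := hbij.2 v
        exact ⟨u, by simpa using hv, rfl⟩
    change q * q ≤ 8 * (Finset.univ.filter fun u => g i u ∈ L ∧ g j u ∉ L).card
    rw [hcard, Finset.card_product, Finset.card_compl, ZMod.card, hL]
    obtain ⟨m, rfl | rfl⟩ : ∃ m, q = 2 * m ∨ q = 2 * m + 1 := ⟨q / 2, by omega⟩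
    · have e1 : 2 * m / 2 = m := by omega
      have e2 : 2 * m - m = m := by omega
      rw [e1, e2]; nlinarith
    · have e1 : (2 * m + 1) / 2 = m := by omega
      have e2 : 2 * m + 1 - m = m + 1 := by omega
      have : 1 ≤ m := by omega
      rw [e1, e2]; nlinarith
  · intro x y z hxy hyz
    refine Finset.disjoint_left.2 fun u hu hu' => ?_
    simp only [Finset.mem_filter, Finset.mem_univ, true_and] at hu hu'
    exact hu.2 hu'.1

end Design

/-! ### The gadget graph for diameters 4 and 5 -/

section Gadget

variable {κ D H P : Type*}

/-- The vertices of the gadget graph: cells `(σ, c, u)`, hubs, and ports `(σ, p)`. -/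
abbrev GadgetVertex (κ D H P : Type*) : Type _ := (Bool × κ × D) ⊕ H ⊕ (Bool × P)

/-- Each hub is joined to all cells of its cluster, each port `(σ, p)` to the cells of its cluster
that are indexed by `S σ p`, and `(σ, p)` to `(!σ, p)`. -/
def GadgetRel (hub : H → Bool × κ) (cl : Bool → P → κ) (S : Bool → P → Finset D) :
    GadgetVertex κ D H P → GadgetVertex κ D H P → Prop
  | .inr (.inl h), .inl (σ, c, _) => hub h = (σ, c)
  | .inr (.inr (σ, p)), .inl (τ, c, u) => σ = τ ∧ cl σ p = c ∧ u ∈ S σ p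
  | .inr (.inr (σ, p)), .inr (.inr (τ, p')) => τ = !σ ∧ p = p'
  | _, _ => False

/-- The gadget graph. -/
def gadgetGraph (hub : H → Bool × κ) (cl : Bool → P → κ) (S : Bool → P → Finset D) :
    SimpleGraph (GadgetVertex κ D H P) :=
  SimpleGraph.fromRel (GadgetRel hub cl S)

variable {hub : H → Bool × κ} {cl : Bool → P → κ} {S : Bool → P → Finset D}

theorem gadgetGraph_adj_hub_cell {h : H} {σ : Bool} {c : κ} (u : D) (hh : hub h = (σ, c)) :
    (gadgetGraph hub cl S).Adj (.inr (.inl h)) (.inl (σ, c, u)) :=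
  (SimpleGraph.fromRel_adj _ _ _).2 ⟨by simp, Or.inl hh⟩

theorem gadgetGraph_adj_port_cell {σ : Bool} {p : P} {u : D} (hu : u ∈ S σ p) :
    (gadgetGraph hub cl S).Adj (.inr (.inr (σ, p))) (.inl (σ, cl σ p, u)) :=
  (SimpleGraph.fromRel_adj _ _ _).2 ⟨by simp, Or.inl ⟨rfl, rfl, hu⟩⟩

theorem gadgetGraph_adj_port_port (σ : Bool) (p : P) :
    (gadgetGraph hub cl S).Adj (.inr (.inr (σ, p))) (.inr (.inr (!σ, p))) :=
  (SimpleGraph.fromRel_adj _ _ _).2 ⟨by simp, Or.inl ⟨rfl, rfl⟩⟩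

/-- Reduces the Lipschitz condition to the three kinds of edges: hub–cell, port–cell and port–port.
-/
theorem gadgetGraph_lipschitz {α : Bool → κ → D → ℕ} {β : Bool → κ → ℕ} {γ : Bool → P → ℕ}
    (hβα : ∀ σ c u, β σ c ≤ α σ c u + 1 ∧ α σ c u ≤ β σ c + 1)
    (hγα : ∀ σ p, ∀ u ∈ S σ p, γ σ p ≤ α σ (cl σ p) u + 1 ∧ α σ (cl σ p) u ≤ γ σ p + 1)
    (hγ : ∀ σ p, γ σ p ≤ γ (!σ) p + 1) :
    ∀ v w, (gadgetGraph hub cl S).Adj v w →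
      Sum.elim (fun x => α x.1 x.2.1 x.2.2) (Sum.elim (fun h => β (hub h).1 (hub h).2)
        (fun x => γ x.1 x.2)) v ≤
      Sum.elim (fun x => α x.1 x.2.1 x.2.2) (Sum.elim (fun h => β (hub h).1 (hub h).2)
        (fun x => γ x.1 x.2)) w + 1 := by
  intro v w hvw
  have h := ((SimpleGraph.fromRel_adj _ _ _).1 hvw).2
  rcases v with ⟨σ, c, u⟩ | h₁ | ⟨σ, p⟩ <;> rcases w with ⟨τ, c', u'⟩ | h₂ | ⟨τ, p'⟩ <;>
    simp only [GadgetRel, or_false, false_or, or_self] at h <;>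
    simp only [Sum.elim_inl, Sum.elim_inr]
  · rw [h]; exact (hβα _ _ _).2
  · obtain ⟨rfl, rfl, hu⟩ := h; exact (hγα _ _ _ hu).2
  · rw [h]; exact (hβα _ _ _).1
  · obtain ⟨rfl, rfl, hu⟩ := h; exact (hγα _ _ _ hu).1
  · rcases h with ⟨rfl, rfl⟩ | ⟨rfl, rfl⟩
    · exact hγ _ _
    · simpa using hγ (!τ) p'

open Classical in
/-- Ports at distance at most `5` lie in a common cluster on their own side, or in a common cluster
with intersecting neighbourhoods on the other side. -/
theorem port_close_of_dist_le_five (σ : Bool) (p p' : P)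
    (h : ∀ φ : GadgetVertex κ D H P → ℕ,
      (∀ u v, (gadgetGraph hub cl S).Adj u v → φ u ≤ φ v + 1) →
        φ (.inr (.inr (σ, p))) ≤ φ (.inr (.inr (σ, p'))) + 5) (hne : cl σ p ≠ cl σ p') :
    cl (!σ) p = cl (!σ) p' ∧ ¬ Disjoint (S (!σ) p) (S (!σ) p') := by
  by_contra hcon
  let C : P → Prop := fun R => cl (!σ) R = cl (!σ) p' ∧ ¬ Disjoint (S (!σ) R) (S (!σ) p')
  -- These functions bound from below the distance to the port `(σ, p')`: its own cluster is near,
  -- the ports met through its partner are at 3, their partners at 4, and the remaining ports on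
  -- side `σ` at 6.
  let γ : Bool → P → ℕ := fun τ R =>
    if τ = σ then
      if R = p' then 0 else if cl σ R = cl σ p' then 2 else if C R then 4 else 6
    else if R = p' then 1 else if cl σ R = cl σ p' ∨ C R then 3 else 5
  let α : Bool → κ → D → ℕ := fun τ c u =>
    if τ = σ then if c = cl σ p' then 1 else 5
    else if c = cl (!σ) p' ∧ u ∈ S (!σ) p' then 2 else 4
  let β : Bool → κ → ℕ := fun τ c => if τ = σ then if c = cl σ p' then 2 else 6 else 3
  have hlip := gadgetGraph_lipschitz (hub := hub) (cl := cl) (S := S) (α := α) (β := β) (γ := γ)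
    (by
      intro τ c u
      simp only [α, β]
      split_ifs <;> omega)
    (by
      intro τ R u hu
      by_cases hτ : τ = σ
      · subst hτ
        by_cases hR : R = p'
        · subst hR; simp [α, γ]
        · simp only [α, γ, if_true, if_neg hR]
          split_ifs <;> omega
      · obtain rfl : τ = !σ := Bool.eq_not_iff.2 hτ
        by_cases hR : R = p'
        · subst hR; simp [α, γ, hu]
        · have hC : cl (!σ) R = cl (!σ) p' ∧ u ∈ S (!σ) p' → C R := fun hh =>
            ⟨hh.1, Finset.not_disjoint_iff.2 ⟨u, hu, hh.2⟩⟩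
          simp only [α, γ, if_neg hτ, if_neg hR]
          by_cases h1 : cl (!σ) R = cl (!σ) p' ∧ u ∈ S (!σ) p'
          · rw [if_pos h1, if_pos (Or.inr (hC h1))]; omega
          · rw [if_neg h1]; split_ifs <;> omega)
    (by
      intro τ R
      by_cases hτ : τ = σ
      · subst hτ
        have : (!τ) ≠ τ := by simp
        simp only [γ, if_true, if_neg this]
        by_cases h1 : R = p' <;> by_cases h2 : cl τ R = cl τ p' <;> by_cases h3 : C R <;>
          simp [h1, h2, h3]
      · obtain rfl : τ = !σ := Bool.eq_not_iff.2 hτ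
        simp only [γ, if_neg hτ, Bool.not_not, if_true]
        by_cases h1 : R = p' <;> by_cases h2 : cl σ R = cl σ p' <;> by_cases h3 : C R <;>
          simp [h1, h2, h3])
  have h6 := h _ hlip
  have hpp : p ≠ p' := fun hpp => hne (by rw [hpp])
  have hCp : ¬ C p := hcon
  simp [γ, hpp, hne, hCp] at h6

open Classical in
/-- If the ports `(false, p)` and `(true, p')` are at distance at most `4`, then the neighbourhoods
of `p` and `p'` meet on one side. -/
theorem port_close_of_dist_le_four (p p' : P)
    (h : ∀ φ : GadgetVertex κ D H P → ℕ,
      (∀ u v, (gadgetGraph hub cl S).Adj u v → φ u ≤ φ v + 1) →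
        φ (.inr (.inr (true, p))) ≤ φ (.inr (.inr (false, p'))) + 4) (hne : p ≠ p') :
    ¬ Disjoint (S false p) (S false p') ∨ ¬ Disjoint (S true p) (S true p') := by
  by_contra hcon
  -- Again lower bounds for the distance, now to `(false, p')`. A port `(true, R)` gets 3 if `R`
  -- meets `p'` on either side, and 5 if on neither and `R ≠ p'`.
  let γ : Bool → P → ℕ := fun τ R =>
    if τ = false then
      if R = p' then 0 else if ¬ Disjoint (S false R) (S false p') then 2 else 4
    else if R = p' then 1
      else if ¬ Disjoint (S false R) (S false p') ∨ ¬ Disjoint (S true R) (S true p') then 3 else 5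
  let α : Bool → κ → D → ℕ := fun τ _ u =>
    if τ = false then if u ∈ S false p' then 1 else 3 else if u ∈ S true p' then 2 else 4
  let β : Bool → κ → ℕ := fun τ _ => if τ = false then 2 else 3
  have hlip := gadgetGraph_lipschitz (hub := hub) (cl := cl) (S := S) (α := α) (β := β) (γ := γ)
    (by
      intro τ c u
      simp only [α, β]
      split_ifs <;> omega)
    (by
      intro τ R u hu
      by_cases hR : R = p'
      · subst hR; cases τ <;> simp [α, γ, hu]
      have hC : u ∈ S τ p' → ¬ Disjoint (S τ R) (S τ p') := fun hh =>
        Finset.not_disjoint_iff.2 ⟨u, hu, hh⟩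
      cases τ
      · simp only [α, γ, if_true, if_neg hR]
        by_cases h1 : u ∈ S false p'
        · simp [h1, hC h1]
        · rw [if_neg h1]; split_ifs <;> omega
      · simp only [α, γ, if_neg hR, Bool.true_eq_false, if_false]
        by_cases h1 : u ∈ S true p'
        · simp [h1, hC h1]
        · rw [if_neg h1]; split_ifs <;> omega)
    (by
      intro τ R
      cases τ <;> simp only [γ, Bool.not_false, Bool.not_true, Bool.true_eq_false, if_true,
        if_false] <;> by_cases h1 : R = p' <;> by_cases h2 : Disjoint (S false R) (S false p') <;>
        by_cases h3 : Disjoint (S true R) (S true p') <;> simp [h1, h2, h3])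
  have h5 := h _ hlip
  simp [γ, hne, hcon] at h5

/-- Fits the gadget into exactly `n` vertices. Ports have the smallest guaranteed degree: an eighth
of a cluster of at least `n / (16 r)` cells, which is where 128 comes from. -/
theorem exists_gadget_coloring {n d r q : ℕ} {ε : ℝ} (hd : 1 ≤ d) (hr : 1 ≤ r) (hq : q.Prime)
    (hq3 : 3 ≤ q) (hn : 8 * r ^ 2 * q ^ 4 ≤ n) (hε : 0 ≤ ε) (hεr : ε * (128 * r) ≤ 1) :
    ∃ R : IncPair q → IncPair q → Prop,
      (∀ x y z, ∀ (hxy : x < y) (hyz : y < z), ¬ R ⟨(x, y), hxy⟩ ⟨(y, z), hyz⟩) ∧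
      (∀ s, R s s) ∧
      ∃ k : (Fin r × Fin r) × (IncPair q × IncPair q) → Fin (coverQ n ε d),
        (d = 5 → ∀ p p', k p = k p' →
          (p.1.1 ≠ p'.1.1 → p.1.2 = p'.1.2 ∧ R p.2.2 p'.2.2) ∧
          (p.1.2 ≠ p'.1.2 → p.1.1 = p'.1.1 ∧ R p.2.1 p'.2.1)) ∧
        (d = 4 → ∀ p p', k p = k p' → p ≠ p' → R p.2.1 p'.2.1 ∨ R p.2.2 p'.2.2) := by
  classical
  have : Fact q.Prime := ⟨hq⟩
  have : Nonempty (Fin r) := ⟨⟨0, hr⟩⟩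
  obtain ⟨T, hTcard, hTdisj⟩ := exists_shift_design hq hq3
  -- Each point of the plane is blown up `t` times. Cells and ports then take at most `n / 4`
  -- vertices each, and the hubs fill up the rest.
  set t := n / (8 * r * q ^ 2) with ht
  have hpos : 0 < 8 * r * q ^ 2 := by positivity
  have hrq : 8 * r * q ^ 2 ≤ n := by
    refine le_trans ?_ hn
    have h1 : r ≤ r ^ 2 := Nat.le_self_pow (by norm_num) r
    have h2 : q ^ 2 ≤ q ^ 4 := Nat.pow_le_pow_right (by omega) (by norm_num)
    gcongr
  have hn0 : 0 < n := by omega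
  have ht1 : 1 ≤ t := (Nat.one_le_div_iff hpos).2 hrq
  have ht2 : t * (8 * r * q ^ 2) ≤ n := Nat.div_mul_le_self _ _
  have ht3 : n < (t + 1) * (8 * r * q ^ 2) := by
    rw [mul_comm]; exact Nat.lt_mul_div_succ n hpos
  have ht4 : n ≤ 16 * r * (t * q ^ 2) := by nlinarith
  let P := (Fin r × Fin r) × (IncPair q × IncPair q)
  let D := Fin t × ZMod q × ZMod q
  have hDcard : Fintype.card D = t * q ^ 2 := by
    simp [D, ZMod.card, sq]
  have hFcard : Fintype.card (IncPair q) ≤ q ^ 2 := by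
    refine (Fintype.card_subtype_le _).trans ?_
    simp [sq]
  have hPcard : 8 * Fintype.card P ≤ n := by
    refine le_trans ?_ hn
    simp only [P, Fintype.card_prod, Fintype.card_fin]
    calc 8 * (r * r * (Fintype.card (IncPair q) * Fintype.card (IncPair q)))
        ≤ 8 * (r * r * (q ^ 2 * q ^ 2)) := by gcongr
      _ = _ := by ring
  have hCcard : 4 * (2 * (r * (t * q ^ 2))) ≤ n := by nlinarith
  obtain ⟨m, hm⟩ : ∃ m, n = 2 * (r * (t * q ^ 2)) + (m + 2 * Fintype.card P) :=
    ⟨n - 2 * (r * (t * q ^ 2)) - 2 * Fintype.card P, by omega⟩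
  obtain ⟨hub, hhub⟩ := exists_balanced_map m (Bool × Fin r)
  rw [Fintype.card_prod, Fintype.card_bool, Fintype.card_fin] at hhub
  let cl : Bool → P → Fin r := fun σ p => if σ then p.1.2 else p.1.1
  let T' : Bool → P → IncPair q := fun σ p => if σ then p.2.2 else p.2.1
  let S : Bool → P → Finset D := fun σ p => Finset.univ ×ˢ T (T' σ p)
  have hX : Fintype.card (GadgetVertex (Fin r) D (Fin m) P) = n := by
    rw [hm, ← hDcard]
    simp only [Fintype.card_sum, Fintype.card_prod, Fintype.card_bool, Fintype.card_fin]
  have hdeg : ∀ s : ℕ, n ≤ 128 * r * s → ε * n ≤ s := by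
    intro s hs
    have hs' : (n : ℝ) ≤ 128 * r * s := by exact_mod_cast hs
    calc ε * n ≤ ε * (128 * r * s) := mul_le_mul_of_nonneg_left hs' hε
      _ = ε * (128 * r) * s := by ring
      _ ≤ 1 * s := mul_le_mul_of_nonneg_right hεr (by positivity)
      _ = s := one_mul _
  obtain ⟨k, hk⟩ := exists_coloring_coverQ (d := d) (ε := ε) hd hn0 hX (gadgetGraph hub cl S) (by
      rintro (⟨σ, c, u⟩ | h | ⟨σ, p⟩)
      · refine ⟨(Finset.univ.filter fun i => hub i = (σ, c)).map
          (Function.Embedding.inl.trans Function.Embedding.inr), ?_, ?_⟩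
        · intro w hw
          obtain ⟨i, hi, rfl⟩ := Finset.mem_map.1 hw
          simp only [Finset.mem_filter, Finset.mem_univ, true_and] at hi
          exact (gadgetGraph_adj_hub_cell u hi).symm
        · rw [Finset.card_map]
          refine hdeg _ ?_
          have h1 := hhub (σ, c)
          have h2 : m < 2 * r * (m / (2 * r) + 1) := Nat.lt_mul_div_succ m (by omega)
          have h3 : 2 * r * (m / (2 * r) + 1)
              ≤ 2 * r * ((Finset.univ.filter fun i => hub i = (σ, c)).card + 1) := by gcongr
          have h4 : 72 * r ≤ n := by
            refine le_trans ?_ hrq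
            have : 3 ^ 2 ≤ q ^ 2 := Nat.pow_le_pow_left hq3 2
            nlinarith
          nlinarith
      · refine ⟨(Finset.univ : Finset D).map
          ⟨fun u => .inl ((hub h).1, (hub h).2, u), fun u v huv => by simpa using huv⟩, ?_, ?_⟩
        · intro w hw
          obtain ⟨u, -, rfl⟩ := Finset.mem_map.1 hw
          exact gadgetGraph_adj_hub_cell u rfl
        · rw [Finset.card_map, Finset.card_univ, hDcard]
          exact hdeg _ (by nlinarith)
      · refine ⟨(S σ p).map
          ⟨fun u => .inl (σ, cl σ p, u), fun u v huv => by simpa using huv⟩, ?_, ?_⟩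
        · intro w hw
          obtain ⟨u, hu, rfl⟩ := Finset.mem_map.1 hw
          exact gadgetGraph_adj_port_cell hu
        · rw [Finset.card_map, Finset.card_product, Finset.card_univ, Fintype.card_fin]
          refine hdeg _ (ht4.trans ?_)
          calc 16 * r * (t * q ^ 2) = 16 * r * (t * (q * q)) := by ring
            _ ≤ 16 * r * (t * (8 * (T (T' σ p)).card)) :=
              Nat.mul_le_mul_left _ (Nat.mul_le_mul_left _ (hTcard _))
            _ = _ := by ring)
    (fun p : P => .inr (.inr (false, p))) (fun p => .inr (.inr (true, p)))
    (fun p => gadgetGraph_adj_port_port false p)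
  have hS : ∀ σ p p', ¬ Disjoint (S σ p) (S σ p') → ¬ Disjoint (T (T' σ p)) (T (T' σ p')) :=
    fun σ p p' h h' => h (Finset.disjoint_product.2 (Or.inr h'))
  refine ⟨fun s s' => ¬ Disjoint (T s) (T s'), fun x y z hxy hyz h => h (hTdisj x y z hxy hyz),
    fun s => ?_, k, ?_, ?_⟩
  · change ¬ Disjoint (T s) (T s)
    rw [disjoint_self, Finset.bot_eq_empty, ← Ne, ← Finset.nonempty_iff_ne_empty,
      ← Finset.card_pos]
    have := hTcard s
    nlinarith
  · rintro rfl p p' hpp'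
    refine ⟨fun hne => ?_, fun hne => ?_⟩
    · have := port_close_of_dist_le_five (hub := hub) (cl := cl) (S := S) false p p'
        (fun φ hφ => (hk p p' hpp' φ hφ).1) hne
      exact ⟨this.1, hS true p p' this.2⟩
    · have := port_close_of_dist_le_five (hub := hub) (cl := cl) (S := S) true p p'
        (fun φ hφ => (hk p p' hpp' φ hφ).2.1) hne
      exact ⟨this.1, hS false p p' this.2⟩
  · rintro rfl p p' hpp' hne
    exact (port_close_of_dist_le_four (hub := hub) (cl := cl) (S := S) p p'
      (fun φ hφ => (hk p p' hpp' φ hφ).2.2) hne).imp (hS false p p') (hS true p p')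

end Gadget

/-! ### Choice of parameters in the lower bounds -/

section LowerBounds

theorem one_le_coverQ {n d : ℕ} {ε : ℝ} (hd : 1 ≤ d) (hn : 2 ≤ n) (hε : ε * n ≤ n - 1) :
    1 ≤ coverQ n ε d := by
  by_contra! h
  obtain ⟨E, hE, -⟩ := hasLowDiamCover_coverQ (ε := ε) hd (by omega)
    (⊤ : SimpleGraph (Fin n)) fun v =>
      ⟨Finset.univ.erase v, fun w hw => by simpa using (Finset.ne_of_mem_erase hw).symm, by
        rw [Finset.cast_card_erase_of_mem (Finset.mem_univ v)]; simpa using hε⟩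
  have h0 : s((⟨0, by omega⟩ : Fin n), ⟨1, by omega⟩) ∈ (⊤ : SimpleGraph (Fin n)).edgeSet := by
    simp
  rw [hE] at h0
  obtain ⟨i, -⟩ := Set.mem_iUnion.1 h0
  exact absurd i.2 (by omega)

theorem le_coverQ_six {n : ℕ} {ε : ℝ} (h1 : 1 / (n : ℝ) ≤ ε) (h2 : ε * n ≤ n - 1) :
    1 / 6 * (1 / ε) ≤ (coverQ n ε 6 : ℝ) := by
  rcases Nat.eq_zero_or_pos n with rfl | hn
  · norm_num at h2
  have hn' : (0 : ℝ) < n := by exact_mod_cast hn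
  have hε : 0 < ε := lt_of_lt_of_le (by positivity) h1
  have h3 : 1 ≤ ε * n := by rwa [div_le_iff₀ hn'] at h1
  -- The factor 3 pays for rounding `n / m` and for the vertex itself, since `ε n ≥ 1`: cliques have
  -- more than `3 ε n - 1 ≥ ε n + 1` vertices.
  set m := ⌊1 / (3 * ε)⌋₊ with hm
  rcases Nat.eq_zero_or_pos m with hm0 | hm0
  · have hn2 : 2 ≤ n := by
      have : (2 : ℝ) ≤ n := by linarith
      exact_mod_cast this
    have h4 : (1 : ℝ) ≤ coverQ n ε 6 := by
      exact_mod_cast one_le_coverQ (d := 6) (by norm_num) hn2 h2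
    have h5 : 1 / (3 * ε) < 1 := by
      rw [hm, Nat.floor_eq_zero] at hm0; exact hm0
    refine le_trans ?_ h4
    rw [div_lt_one (by positivity)] at h5
    rw [← mul_div_assoc, div_le_one hε]
    linarith
  · have hm1 : (m : ℝ) ≤ 1 / (3 * ε) := Nat.floor_le (by positivity)
    have hm2 : 1 / (3 * ε) < m + 1 := Nat.lt_floor_add_one _
    have hm3 : (1 : ℝ) ≤ m := by exact_mod_cast hm0
    have hmε : m * (3 * ε) ≤ 1 := by rwa [le_div_iff₀ (by positivity)] at hm1
    have h4 : m ≤ coverQ n ε 6 := by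
      refine card_le_coverQ_of_cliques (by norm_num) hn hm0 ?_ hε
      have h5 : (n : ℝ) < m * ((n / m : ℕ) + 1) := by
        exact_mod_cast Nat.lt_mul_div_succ n hm0
      have h6 : m * (3 * (ε * n)) < m * (((n / m : ℕ) : ℝ) + 1) := by
        refine lt_of_le_of_lt ?_ h5
        nlinarith
      have h7 := lt_of_mul_lt_mul_left h6 (by positivity)
      linarith
    have h8 : (m : ℝ) ≤ coverQ n ε 6 := by exact_mod_cast h4
    have h9 : 1 / 6 * (1 / ε) = 1 / (3 * ε) / 2 := by field_simp; norm_num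
    rw [h9]
    linarith

theorem le_coverQ_five {n : ℕ} {ε : ℝ} (h1 : 1 * Real.logb 2 (n : ℝ) ^ (-(1 / 3) : ℝ) < ε)
    (h2 : ε * n ≤ n - 1) : 1 / 2 ^ 17 * (1 / ε ^ 2) ≤ (coverQ n ε 5 : ℝ) := by
  rw [one_mul] at h1
  have hlog0 : 0 ≤ Real.logb 2 (n : ℝ) := by
    rcases Nat.eq_zero_or_pos n with rfl | hn
    · simp
    · exact Real.logb_nonneg (by norm_num) (by exact_mod_cast hn)
  have hε : 0 < ε := lt_of_le_of_lt (Real.rpow_nonneg hlog0 _) h1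
  have hn2 : 2 ≤ n := by
    rcases Nat.lt_or_ge n 2 with h | h
    · interval_cases n <;> norm_num at h2 <;> linarith
    · exact h
  have hn' : (0 : ℝ) < n := by positivity
  set r := ⌊1 / (128 * ε)⌋₊ with hr
  rcases Nat.eq_zero_or_pos r with hr0 | hr0
  · have h4 : (1 : ℝ) ≤ coverQ n ε 5 := by
      exact_mod_cast one_le_coverQ (d := 5) (by norm_num) hn2 h2
    have h5 : 1 / (128 * ε) < 1 := by
      rw [hr, Nat.floor_eq_zero] at hr0; exact hr0
    refine le_trans ?_ h4
    rw [div_lt_one (by positivity)] at h5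
    rw [← mul_div_assoc, div_le_one (by positivity)]
    nlinarith
  have hr1 : (r : ℝ) ≤ 1 / (128 * ε) := Nat.floor_le (by positivity)
  have hr2 : 1 / (128 * ε) < r + 1 := Nat.lt_floor_add_one _
  have hr3 : (1 : ℝ) ≤ r := by exact_mod_cast hr0
  have hrε : ε * (128 * r) ≤ 1 := by
    rw [le_div_iff₀ (by positivity)] at hr1; linarith
  have hlog1 : 0 < Real.logb 2 (n : ℝ) :=
    Real.logb_pos (by norm_num) (by exact_mod_cast hn2)
  -- The hypothesis on `ε` and `128 r ε ≤ 1` give `(128 r)³ ≤ log n`; the constant 12 is what `5 r²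
  -- + 7 ≤ 12 r³` needs below.
  have hlog : (12 * r ^ 3 : ℝ) ≤ Real.logb 2 n := by
    set y := Real.logb 2 (n : ℝ) ^ (-(1 / 3) : ℝ) with hy
    have hy0 : 0 < y := Real.rpow_pos_of_pos hlog1 _
    have hy3 : y ^ 3 * Real.logb 2 n = 1 := by
      rw [hy, ← Real.rpow_natCast, ← Real.rpow_mul hlog1.le]
      norm_num
      rw [Real.rpow_neg_one]
      exact inv_mul_cancel₀ hlog1.ne'
    have hyr : y * (128 * r) ≤ 1 := le_trans (by gcongr) hrε
    have h5 : (y * (128 * r)) ^ 3 ≤ 1 := pow_le_one₀ (by positivity) hyr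
    have h6 : y ^ 3 * (12 * r ^ 3) ≤ y ^ 3 * Real.logb 2 n := by
      rw [hy3]
      have : 0 ≤ y ^ 3 * (r : ℝ) ^ 3 := by positivity
      nlinarith
    exact le_of_mul_le_mul_left h6 (by positivity)
  have hpow : 2 ^ (12 * r ^ 3) ≤ n := by
    rw [Real.le_logb_iff_rpow_le (by norm_num) hn'] at hlog
    have : ((12 * r ^ 3 : ℕ) : ℝ) = 12 * (r : ℝ) ^ 3 := by push_cast; ring
    rw [← this, Real.rpow_natCast] at hlog
    exact_mod_cast hlog
  -- The shift argument needs `q > 2 ^ r²`; the upper bound on `q` keeps the gadget within `n`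
  -- vertices.
  obtain ⟨q, hq, hq1, hq2⟩ := Nat.exists_prime_lt_and_le_two_mul (2 ^ (r * r)) (by positivity)
  have hq3 : 3 ≤ q := by
    have : 2 ^ 1 ≤ 2 ^ (r * r) := Nat.pow_le_pow_right (by norm_num) (Nat.mul_pos hr0 hr0)
    omega
  have hnq : 8 * r ^ 2 * q ^ 4 ≤ n := by
    refine le_trans ?_ hpow
    calc 8 * r ^ 2 * q ^ 4 ≤ 8 * 2 ^ (r ^ 2) * (2 * 2 ^ (r * r)) ^ 4 := by
          exact Nat.mul_le_mul (Nat.mul_le_mul_left _ Nat.lt_two_pow_self.le)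
            (Nat.pow_le_pow_left hq2 4)
      _ = 2 ^ (5 * r ^ 2 + 7) := by ring
      _ ≤ 2 ^ (12 * r ^ 3) := by
          refine Nat.pow_le_pow_right (by norm_num) ?_
          have h7 : r ^ 2 ≤ r ^ 3 := Nat.pow_le_pow_right hr0 (by norm_num)
          have h8 : 1 ≤ r ^ 3 := Nat.one_le_pow _ _ hr0
          omega
  obtain ⟨R, hR, -, k, hk, -⟩ :=
    exists_gadget_coloring (d := 5) (by norm_num) hr0 hq hq3 hnq hε.le hrε
  have hfin := mul_self_le_two_mul_of_coloring hR hq1 k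
    (fun p p' h => (hk rfl p p' h).1) (fun p p' h => (hk rfl p p' h).2)
  have hfin' : (r : ℝ) * r ≤ 2 * coverQ n ε 5 := by exact_mod_cast hfin
  -- Here `2 ^ 17 = 128² · 8`, from `1 / (128 ε) ≤ 2 r` and `r² ≤ 2 l`, with `l` the cover number.
  have h9 : 1 / 2 ^ 17 * (1 / ε ^ 2) = (1 / (128 * ε)) ^ 2 / 8 := by field_simp; norm_num
  have h10 : (1 / (128 * ε)) ^ 2 ≤ (2 * r) ^ 2 :=
    pow_le_pow_left₀ (by positivity) (by linarith) 2
  rw [h9]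
  nlinarith

theorem le_coverQ_four {n j : ℕ} {ε : ℝ} (hj : 1 ≤ j) (hn : 2 ^ (4 * j + 7) ≤ n) (hε : 0 ≤ ε)
    (hε1 : ε * 128 ≤ 1) : j ≤ coverQ n ε 4 := by
  obtain ⟨q, hq, hq1, hq2⟩ := Nat.exists_prime_lt_and_le_two_mul (2 ^ j) (by positivity)
  have hq3 : 3 ≤ q := by
    have : 2 ^ 1 ≤ 2 ^ j := Nat.pow_le_pow_right (by norm_num) hj
    omega
  have hnq : 8 * 1 ^ 2 * q ^ 4 ≤ n := by
    refine le_trans ?_ hn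
    calc 8 * 1 ^ 2 * q ^ 4 ≤ 8 * 1 ^ 2 * (2 * 2 ^ j) ^ 4 := by gcongr
      _ = 2 ^ (4 * j + 7) := by ring
  obtain ⟨R, hR, hRr, k, -, hk⟩ :=
    exists_gadget_coloring (d := 4) (by norm_num) le_rfl hq hq3 hnq hε (by simpa using hε1)
  -- On the diagonal `s = s'` both alternatives for ports at distance 4 become the same relation.
  have h1 := le_two_pow_of_coloring hR (fun s => k ((0, 0), (s, s))) (fun s s' h => by
    by_cases hss : s = s'
    · subst hss; exact hRr s
    · have := hk rfl _ _ h (by simpa using hss)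
      simpa using this)
  exact ((Nat.pow_lt_pow_iff_right (by norm_num : 1 < 2)).1 (hq1.trans_le h1)).le

end LowerBounds

/-! ### Assembling the theorem -/

theorem theorem2 :
    -- (a) for fixed `0 < ε ≤ 2⁻⁸`, as `n → ∞`
    (∀ ε : ℝ, 0 < ε → ε ≤ (2 : ℝ)⁻¹ ^ 8 →
      Asymptotics.IsTheta Filter.atTop
        (fun n : ℕ => (coverQ n ε 3 : ℝ)) (fun n : ℕ => Real.logb 2 (n : ℝ)) ∧
      Asymptotics.IsTheta Filter.atTop
        (fun n : ℕ => (coverQ n ε 4 : ℝ)) (fun n : ℕ => Real.logb 2 (n : ℝ))) ∧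
    -- (b) diameter 5, upper bound
    (∃ C : ℝ, 0 < C ∧ ∀ (n : ℕ) (ε : ℝ), 0 < ε →
      (coverQ n ε 5 : ℝ) ≤ C * (1 / ε ^ 2)) ∧
    -- (b) diameter 5, lower bound
    (∃ c c' : ℝ, 0 < c ∧ 0 < c' ∧ ∀ (n : ℕ) (ε : ℝ),
      c' * Real.logb 2 (n : ℝ) ^ (-(1 / 3) : ℝ) < ε → ε * (n : ℝ) ≤ (n : ℝ) - 1 →
      c * (1 / ε ^ 2) ≤ (coverQ n ε 5 : ℝ)) ∧
    -- (b) diameter 6, upper bound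
    (∃ C : ℝ, 0 < C ∧ ∀ (n : ℕ) (ε : ℝ), 0 < ε →
      (coverQ n ε 6 : ℝ) ≤ C * (1 / ε)) ∧
    -- (b) diameter 6, lower bound
    (∃ c : ℝ, 0 < c ∧ ∀ (n : ℕ) (ε : ℝ),
      1 / (n : ℝ) ≤ ε → ε * (n : ℝ) ≤ (n : ℝ) - 1 →
      c * (1 / ε) ≤ (coverQ n ε 6 : ℝ)) := by
  refine ⟨fun ε hε hε8 => ?_,
    ⟨1, one_pos, fun n ε hε => by simpa using coverQ_five_le n hε⟩,
    ⟨1 / 2 ^ 17, 1, by norm_num, one_pos, fun n ε h1 h2 => le_coverQ_five h1 h2⟩,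
    ⟨1, one_pos, fun n ε hε => by simpa using coverQ_six_le n hε⟩,
    ⟨1 / 6, by norm_num, fun n ε h1 h2 => le_coverQ_six h1 h2⟩⟩
  norm_num at hε8
  have hanti : ∀ n, (coverQ n ε 4 : ℝ) ≤ coverQ n ε 3 := fun n => by
    exact_mod_cast coverQ_anti_diam n ε (d := 3) (d' := 4) (by norm_num) (by norm_num)
  have hupper : (fun n : ℕ => (coverQ n ε 3 : ℝ)) =O[Filter.atTop]
      fun n : ℕ => Real.logb 2 (n : ℝ) := by
    refine Asymptotics.IsBigO.of_bound (2 / ε ^ 2 + 2) ?_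
    filter_upwards [Filter.eventually_ge_atTop 2] with n hn
    have hn' : (2 : ℝ) ≤ n := by exact_mod_cast hn
    have hlogb : 1 ≤ Real.logb 2 n := by
      rw [Real.le_logb_iff_rpow_le (by norm_num) (by linarith)]
      simpa using hn'
    have hlog : Real.log n ≤ Real.logb 2 n := by
      rw [Real.logb, le_div_iff₀ (Real.log_pos (by norm_num))]
      have h1 := Real.log_two_lt_d9
      have h2 : 0 ≤ Real.log n := Real.log_nonneg (by linarith)
      nlinarith
    rw [Real.norm_of_nonneg (by positivity), Real.norm_of_nonneg (by linarith)]
    calc (coverQ n ε 3 : ℝ) ≤ 2 * Real.log n / ε ^ 2 + 2 :=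
          coverQ_three_le (by omega) hε (by linarith)
      _ ≤ 2 * Real.logb 2 n / ε ^ 2 + 2 * Real.logb 2 n := by
          gcongr
          linarith
      _ = _ := by ring
  have hlower : (fun n : ℕ => Real.logb 2 (n : ℝ)) =O[Filter.atTop]
      fun n : ℕ => (coverQ n ε 4 : ℝ) := by
    -- With `j = (log n - 7) / 4 ≥ 1`, rounded down, `log n + 1 ≤ 4 j + 11 ≤ 15 j`.
    refine Asymptotics.IsBigO.of_bound 15 ?_
    filter_upwards [Filter.eventually_ge_atTop (2 ^ 11)] with n hn
    have hn0 : n ≠ 0 := by omega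
    have hL : 11 ≤ Nat.log 2 n := (Nat.le_log_iff_pow_le (by norm_num) hn0).2 hn
    have hpow : 2 ^ (4 * ((Nat.log 2 n - 7) / 4) + 7) ≤ n :=
      (Nat.pow_le_pow_right (by norm_num) (by omega)).trans (Nat.pow_log_le_self 2 hn0)
    have h1 := le_coverQ_four (ε := ε) (by omega) hpow hε.le (by linarith)
    have h2 : Nat.log 2 n + 1 ≤ 15 * coverQ n ε 4 := by omega
    have h3 : Real.logb 2 n ≤ (Nat.log 2 n + 1 : ℕ) := by
      rw [Real.logb_le_iff_le_rpow (by norm_num) (by positivity), Real.rpow_natCast]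
      exact_mod_cast (Nat.lt_pow_succ_log_self (by norm_num) n).le
    rw [Real.norm_of_nonneg (Real.logb_nonneg (by norm_num)
      (by exact_mod_cast Nat.pos_of_ne_zero hn0)), Real.norm_of_nonneg (by positivity)]
    exact h3.trans (by exact_mod_cast h2)
  have hle : (fun n : ℕ => (coverQ n ε 4 : ℝ)) =O[Filter.atTop]
      fun n : ℕ => (coverQ n ε 3 : ℝ) :=
    Asymptotics.IsBigO.of_bound 1 (Filter.Eventually.of_forall fun n => by
      rw [Real.norm_of_nonneg (by positivity), Real.norm_of_nonneg (by positivity), one_mul]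
      exact hanti n)
  exact ⟨⟨hupper, hlower.trans hle⟩, ⟨hle.trans hupper, hlower⟩⟩
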